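/- Theorem. Let $n_1,n_2\ge 1$ and $p,q\ge 0$ be integers, and let $\mathbb S^k\subset\mathbb R^{k+1}$ denote the unit sphere. A smooth immersion $f:M\to\mathbb S^k$ of a smooth manifold without boundary is called minimal if its mean curvature vector $\vec H=\sum_i(\bar\nabla_{e_i}e_i)^\perp$ vanishes at every point, where $\bar\nabla$ is the Levi-Civita connection of $\mathbb S^k$, $e_1,e_2,\dots$ is a local orthonormal frame of the immersed submanifold, and $\perp$ denotes the component in $T\mathbb S^k$ normal to it. Let $\Sigma_1$ be a minimal submanifold of $\mathbb S^p$ of dimension $n_1$ and $\Sigma_2$ a minimal submanifold of $\mathbb S^q$ of dimension $n_2$, given by minimal immersions $f_1:M_1^{n_1}\to\mathbb S^p$ and $f_2:M_2^{n_2}\to\mathbb S^q$ of smooth manifolds without boundary. Then the scaled product $$\sqrt{\tfrac{n_1}{n_1+n_2}}\,\Sigma_1\times\sqrt{\tfrac{n_2}{n_1+n_2}}\,\Sigma_2\subset\mathbb R^{p+1}\times\mathbb R^{q+1}=\mathbb R^{p+q+2}$$ is a minimal submanifold of $\mathbb S^{p+q+1}$: the map $$F:M_1\times M_2\to\mathbb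 R^{p+q+2},\qquad F(x,y)=\Big(\sqrt{\tfrac{n_1}{n_1+n_2}}\,f_1(x),\ \sqrt{\tfrac{n_2}{n_1+n_2}}\,f_2(y)\Big)$$ takes its values in $\mathbb S^{p+q+1}$ and is a minimal immersion into $\mathbb S^{p+q+1}$. Moreover, if $f_1$ and $f_2$ are embeddings, then so is $F$. -/

import Mathlib

open scoped Manifold ContDiff

noncomputable section

/-- The unit sphere `𝕊^p` in `ℝ^(p+1)`, with Mathlib's smooth structure. -/
abbrev UnitSphere (p : ℕ) : Type :=
  Metric.sphere (0 : EuclideanSpace ℝ (Fin (p + 1))) 1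

section Curvature

variable {E : Type*} [NormedAddCommGroup E] [NormedSpace ℝ E]
  {H : Type*} [TopologicalSpace H] (I : ModelWithCorners ℝ E H)
  {M : Type*} [TopologicalSpace M] [ChartedSpace H M]
  {V : Type*} [NormedAddCommGroup V] [InnerProductSpace ℝ V] [FiniteDimensional ℝ V]

/-- The differential at `x` of a map `f : M → V`; here `E` is `TangentSpace I x` and `V` is its own
tangent space at `f x`. -/
def ambientDifferential (f : M → V) (x : M) : E →L[ℝ] V :=
  mfderiv I 𝓘(ℝ, V) f x

/-- The tangent space at `x` of an immersed submanifold `f : M → V`, as a subspace of the ambient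
Euclidean space `V`. -/
def tangentSubspace (f : M → V) (x : M) : Submodule ℝ V :=
  LinearMap.range (ambientDifferential I f x : E →ₗ[ℝ] V)

/-- For `f : M → V` with values in the unit sphere of `V`: the normal space at `x` of the
submanifold inside the sphere, i.e. the vectors that are tangent to the sphere at `f x`
(orthogonal to the position vector `f x`) and orthogonal to the submanifold. -/
def sphereNormalSubspace (f : M → V) (x : M) : Submodule ℝ V :=
  (tangentSubspace I f x ⊔ Submodule.span ℝ {f x})ᗮ

/-- The second fundamental form `(∇̄_v w)^⊥` at `x` of the immersed submanifold `f : M → V` of the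
unit sphere of `V`, where `∇̄` is the Levi-Civita connection of the sphere.
The vectors `v, w` are extended to coordinate fields with constant coefficients in the preferred
chart at `x` (the chart that identifies `TangentSpace I x` with `E`, so that `v w : E`). As `∇̄` is
the derivative in `V` followed by the projection to the tangent space of the sphere, `(∇̄_v w)^⊥` is
the projection of the second derivative of `f` in this chart to the normal space. -/
def sphereSecondFundamentalForm (f : M → V) (x : M) (v w : E) : V :=
  (sphereNormalSubspace I f x).starProjection
    (fderiv ℝ (fderiv ℝ (f ∘ (extChartAt I x).symm)) (extChartAt I x x) v w)

/-- The tangent vectors of `M` at `x` whose images under the differential of `f` form an orthonormal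
basis of the tangent subspace. -/
def orthonormalFrame (f : M → V) (x : M)
    (i : Fin (Module.finrank ℝ (tangentSubspace I f x))) : E :=
  (LinearMap.mem_range.mp (stdOrthonormalBasis ℝ (tangentSubspace I f x) i).2).choose

/-- The mean curvature vector `∑ (∇̄_{e_i} e_i)^⊥` at `x` of the immersed submanifold `f : M → V` of
the unit sphere of `V`, where `e_i` is an orthonormal frame of the submanifold at `x`. -/
def sphereMeanCurvature (f : M → V) (x : M) : V :=
  ∑ i, sphereSecondFundamentalForm I f x (orthonormalFrame I f x i) (orthonormalFrame I f x i)

/-- `f : M → 𝕊^p` is a minimal immersion, i.e. it presents `M` as an (immersed) minimal submanifold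
of `𝕊^p`: it is a smooth immersion with vanishing mean curvature vector. -/
structure IsMinimalInSphere [I.Boundaryless] {p : ℕ} (f : M → UnitSphere p) : Prop where
  contMDiff : ContMDiff I (𝓡 p) ∞ f
  immersion : ∀ x, Function.Injective (mfderiv I (𝓡 p) f x)
  meanCurvature_eq_zero : ∀ x,
    sphereMeanCurvature I (fun y => (f y : EuclideanSpace ℝ (Fin (p + 1)))) x = 0

end Curvature

/-- The identification `ℝ^(p+1) × ℝ^(q+1) = ℝ^(p+q+2)`: the coordinates of `x` followed by those
of `y`. -/
def blockVector {p q : ℕ} (x : EuclideanSpace ℝ (Fin (p + 1)))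
    (y : EuclideanSpace ℝ (Fin (q + 1))) : EuclideanSpace ℝ (Fin (p + q + 1 + 1)) :=
  WithLp.toLp 2 fun i => Fin.append x.ofLp y.ofLp (Fin.cast (by omega) i)

end

/-! This is Takahashi's criterion, read in charts. Minimality of an immersion `f` into the unit
sphere means that the trace of its second derivative lies in the span of the tangent space and `f
x`. Differentiating `⟪f, f⟫ = 1` twice shows that the coefficient of `f x` is minus the dimension
(`exists_sum_fderiv_fderiv_orthonormalFrame_eq`). The tangent part stays arbitrary, so
chart-dependent connection terms never matter.

Scaling the factors by `√r₁`, `√r₂` multiplies their traces by `1 / r₁`, `1 / r₂`, and the product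
has no mixed second derivatives. Its trace is thus tangent plus `-(n₁ / r₁)` and `-(n₂ / r₂)` times
the two blocks of the position vector. For `r_k = n_k / (n₁ + n₂)` both coefficients are `-(n₁ +
n₂)`, so the trace has no normal part (`injective_and_sphereMeanCurvature_add_prod`). -/

/-- The vectors `e i` reproduce every vector from its inner products taken through `D`. If `D` is
injective, this says that the images `D (e i)` form a Parseval frame of the range of `D`. -/
def IsReproducingFrame {ι E V : Type*} [Fintype ι] [NormedAddCommGroup E] [NormedSpace ℝ E]
    [NormedAddCommGroup V] [InnerProductSpace ℝ V] (D : E →L[ℝ] V) (e : ι → E) : Prop :=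
  ∀ v, ∑ i, inner ℝ (D (e i)) (D v) • e i = v

/-! ### Traces in reproducing frames. -/

section Frames

variable {ι κ E V W : Type*} [Fintype ι] [Fintype κ] [NormedAddCommGroup E] [NormedSpace ℝ E]
  [NormedAddCommGroup V] [InnerProductSpace ℝ V] [NormedAddCommGroup W] [NormedSpace ℝ W]

/-- The trace of a bilinear map does not depend on the frame in which it is computed. -/
theorem IsReproducingFrame.sum_diagonal_eq {D : E →L[ℝ] V} {e : ι → E} {e' : κ → E}
    (he : IsReproducingFrame D e) (he' : IsReproducingFrame D e') (B : E →L[ℝ] E →L[ℝ] W) :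
    ∑ i, B (e i) (e i) = ∑ j, B (e' j) (e' j) := by
  calc ∑ i, B (e i) (e i)
      = ∑ i, ∑ j, inner ℝ (D (e' j)) (D (e i)) • B (e' j) (e i) := by
        refine Finset.sum_congr rfl fun i _ => ?_
        -- After the flip only the first slot of `B` is expanded in `e'`.
        rw [← ContinuousLinearMap.flip_apply]
        conv_lhs => enter [2]; rw [← he' (e i)]
        simp [map_sum]
    _ = ∑ j, ∑ i, inner ℝ (D (e i)) (D (e' j)) • B (e' j) (e i) := by
        rw [Finset.sum_comm]
        simp_rw [real_inner_comm]
    _ = ∑ j, B (e' j) (e' j) := by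
        refine Finset.sum_congr rfl fun j _ => ?_
        conv_rhs => enter [2]; rw [← he (e' j)]
        simp [map_sum]

end Frames

/-! ### Mean curvature as the normal part of a trace. -/

section Immersions

variable {E : Type*} [NormedAddCommGroup E] [NormedSpace ℝ E]
  {H : Type*} [TopologicalSpace H] (I : ModelWithCorners ℝ E H)
  {M : Type*} [TopologicalSpace M] [ChartedSpace H M]
  {V : Type*} [NormedAddCommGroup V] [InnerProductSpace ℝ V] [FiniteDimensional ℝ V]

theorem ambientDifferential_orthonormalFrame (f : M → V) (x : M)
    (i : Fin (Module.finrank ℝ (tangentSubspace I f x))) :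
    ambientDifferential I f x (orthonormalFrame I f x i) =
      stdOrthonormalBasis ℝ (tangentSubspace I f x) i :=
  (LinearMap.mem_range.mp (stdOrthonormalBasis ℝ (tangentSubspace I f x) i).2).choose_spec

theorem isReproducingFrame_orthonormalFrame {f : M → V} {x : M}
    (hf : Function.Injective (ambientDifferential I f x)) :
    IsReproducingFrame (ambientDifferential I f x) (orthonormalFrame I f x) := by
  intro v
  -- After applying the injective differential, this is the expansion in an orthonormal basis of the
  -- tangent subspace.
  apply hf
  have h := congrArg Subtype.val ((stdOrthonormalBasis ℝ (tangentSubspace I f x)).sum_repr'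
    ⟨ambientDifferential I f x v, LinearMap.mem_range_self _ v⟩)
  simp only [AddSubmonoidClass.coe_finsetSum, SetLike.val_smul, Submodule.coe_inner] at h
  simpa only [map_sum, map_smul, ambientDifferential_orthonormalFrame] using h

theorem sum_norm_sq_orthonormalFrame {f : M → V} {x : M}
    (hf : Function.Injective (ambientDifferential I f x)) :
    ∑ i, ‖ambientDifferential I f x (orthonormalFrame I f x i)‖ ^ 2 =
      (Module.finrank ℝ E : ℝ) := by
  have h : ∀ i, ‖ambientDifferential I f x (orthonormalFrame I f x i)‖ = 1 := fun i => by
    rw [ambientDifferential_orthonormalFrame]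
    exact (stdOrthonormalBasis ℝ (tangentSubspace I f x)).orthonormal.1 i
  simp only [h, one_pow, Finset.sum_const, Finset.card_univ, Fintype.card_fin, nsmul_eq_mul,
    mul_one]
  exact congrArg _ (LinearMap.finrank_range_of_inj hf)

/-- The mean curvature vector, computed in any reproducing frame. -/
theorem sphereMeanCurvature_eq {ι : Type*} [Fintype ι] {f : M → V} {x : M} {e : ι → E}
    (hf : Function.Injective (ambientDifferential I f x))
    (he : IsReproducingFrame (ambientDifferential I f x) e) :
    sphereMeanCurvature I f x = (sphereNormalSubspace I f x).starProjection
      (∑ i, fderiv ℝ (fderiv ℝ (f ∘ (extChartAt I x).symm)) (extChartAt I x x) (e i) (e i)) := by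
  rw [← (isReproducingFrame_orthonormalFrame I hf).sum_diagonal_eq he, map_sum]
  rfl

/-- In finite dimension the double orthogonal complement is the subspace itself, so vanishing mean
curvature becomes an equation with explicit witnesses. -/
theorem starProjection_sphereNormalSubspace_eq_zero_iff {f : M → V} {x : M} {w : V} :
    (sphereNormalSubspace I f x).starProjection w = 0 ↔
      ∃ (v : E) (c : ℝ), w = ambientDifferential I f x v + c • f x := by
  rw [Submodule.starProjection_apply_eq_zero_iff, sphereNormalSubspace,
    Submodule.orthogonal_orthogonal, Submodule.mem_sup]
  simp only [tangentSubspace, LinearMap.mem_range, Submodule.mem_span_singleton]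
  constructor
  · rintro ⟨_, ⟨v, rfl⟩, _, ⟨c, rfl⟩, h⟩
    exact ⟨v, c, h.symm⟩
  · rintro ⟨v, c, rfl⟩
    exact ⟨_, ⟨v, rfl⟩, _, ⟨c, rfl⟩, rfl⟩

end Immersions

/-! ### Differentials in charts. -/

section Charts

variable {E : Type*} [NormedAddCommGroup E] [NormedSpace ℝ E]
  {H : Type*} [TopologicalSpace H] (I : ModelWithCorners ℝ E H) [I.Boundaryless]
  {M : Type*} [TopologicalSpace M] [ChartedSpace H M]
  {V : Type*} [NormedAddCommGroup V] [InnerProductSpace ℝ V]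

theorem ambientDifferential_eq_fderiv {f : M → V} {x : M} (hf : MDifferentiableAt I 𝓘(ℝ, V) f x) :
    ambientDifferential I f x = fderiv ℝ (f ∘ (extChartAt I x).symm) (extChartAt I x x) := by
  have h : ambientDifferential I f x =
      fderivWithin ℝ (f ∘ (extChartAt I x).symm) (Set.range I) (extChartAt I x x) := by
    unfold ambientDifferential mfderiv
    exact if_pos hf
  rw [h, I.range_eq_univ, fderivWithin_univ]

theorem ContMDiff.contDiffAt_comp_extChartAt_symm {n : ℕ∞ω} {f : M → V}
    (hf : ContMDiff I 𝓘(ℝ, V) n f) (x : M) :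
    ContDiffAt ℝ n (f ∘ (extChartAt I x).symm) (extChartAt I x x) := by
  have h := (contMDiffAt_iff.mp (hf x)).2
  rw [I.range_eq_univ, contDiffWithinAt_univ] at h
  exact h

end Charts

/-! ### Second derivatives of maps of constant norm. -/

section SecondDerivative

variable {E V W : Type*} [NormedAddCommGroup E] [NormedSpace ℝ E]
  [NormedAddCommGroup V] [InnerProductSpace ℝ V] [NormedAddCommGroup W] [NormedSpace ℝ W]

theorem ContDiffAt.differentiableAt_fderiv {g : E → W} {u : E} (hg : ContDiffAt ℝ 2 g u) :
    DifferentiableAt ℝ (fderiv ℝ g) u :=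
  (hg.fderiv_right (m := 1) (by norm_num)).differentiableAt (by norm_num)

theorem ContDiffAt.eventually_differentiableAt {g : E → W} {u : E} (hg : ContDiffAt ℝ 2 g u) :
    ∀ᶠ v in nhds u, DifferentiableAt ℝ g v :=
  (hg.eventually (by simp)).mono fun _ h => h.differentiableAt (by norm_num)

/-- Differentiating `⟪g, g⟫ = const` once. -/
theorem inner_fderiv_eq_zero {g : E → V} {u : E} {r : ℝ} (hg : DifferentiableAt ℝ g u)
    (hr : ∀ v, ‖g v‖ = r) (w : E) : inner ℝ (g u) (fderiv ℝ g u w) = 0 := by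
  have h := hg.hasFDerivAt.inner ℝ hg.hasFDerivAt
  have hc : (fun v => inner ℝ (g v) (g v)) = fun _ => r ^ 2 := by
    funext v; rw [real_inner_self_eq_norm_sq, hr]
  rw [hc] at h
  have h0 := congrArg (fun L : E →L[ℝ] ℝ => L w) (h.unique (hasFDerivAt_const _ u))
  simp only [ContinuousLinearMap.comp_apply, ContinuousLinearMap.prod_apply, fderivInnerCLM_apply,
    zero_apply] at h0
  rw [real_inner_comm (g u) (fderiv ℝ g u w)] at h0
  linarith

/-- Differentiating `⟪g, g⟫ = const` twice. -/
theorem inner_fderiv_fderiv_eq {g : E → V} {u : E} {r : ℝ} (hg : ContDiffAt ℝ 2 g u)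
    (hr : ∀ v, ‖g v‖ = r) (v w : E) :
    inner ℝ (g u) (fderiv ℝ (fderiv ℝ g) u v w) = -inner ℝ (fderiv ℝ g u v) (fderiv ℝ g u w) := by
  have h := (hg.differentiableAt (by norm_num)).hasFDerivAt.inner ℝ
    (hg.differentiableAt_fderiv.hasFDerivAt.clm_apply (hasFDerivAt_const w u))
  have hc : (fun v => inner ℝ (g v) (fderiv ℝ g v w)) =ᶠ[nhds u] fun _ => (0 : ℝ) :=
    hg.eventually_differentiableAt.mono fun v hv => inner_fderiv_eq_zero hv hr w
  have h0 := congrArg (fun L : E →L[ℝ] ℝ => L v)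
    ((h.congr_of_eventuallyEq hc.symm).unique (hasFDerivAt_const _ u))
  simp at h0
  linarith

end SecondDerivative

/-! ### Derivatives of sums of maps in separate variables. -/

section SumMaps

variable {E₁ E₂ V₁ V₂ V : Type*} [NormedAddCommGroup E₁] [NormedSpace ℝ E₁]
  [NormedAddCommGroup E₂] [NormedSpace ℝ E₂] [NormedAddCommGroup V₁] [NormedSpace ℝ V₁]
  [NormedAddCommGroup V₂] [NormedSpace ℝ V₂] [NormedAddCommGroup V] [NormedSpace ℝ V]
  (L₁ : V₁ →L[ℝ] V) (L₂ : V₂ →L[ℝ] V) {g₁ : E₁ → V₁} {g₂ : E₂ → V₂}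

theorem hasFDerivAt_add_prod {u : E₁ × E₂} (h₁ : DifferentiableAt ℝ g₁ u.1)
    (h₂ : DifferentiableAt ℝ g₂ u.2) :
    HasFDerivAt (fun z : E₁ × E₂ => L₁ (g₁ z.1) + L₂ (g₂ z.2))
      (L₁ ∘L fderiv ℝ g₁ u.1 ∘L .fst ℝ E₁ E₂ + L₂ ∘L fderiv ℝ g₂ u.2 ∘L .snd ℝ E₁ E₂) u :=
  (L₁.hasFDerivAt.comp u (h₁.hasFDerivAt.comp u hasFDerivAt_fst)).add
    (L₂.hasFDerivAt.comp u (h₂.hasFDerivAt.comp u hasFDerivAt_snd))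

/-- Each summand depends on one factor only, so no mixed terms arise. -/
theorem fderiv_fderiv_add_prod {u : E₁ × E₂} (h₁ : ContDiffAt ℝ 2 g₁ u.1)
    (h₂ : ContDiffAt ℝ 2 g₂ u.2) (v w : E₁ × E₂) :
    fderiv ℝ (fderiv ℝ fun z : E₁ × E₂ => L₁ (g₁ z.1) + L₂ (g₂ z.2)) u v w =
      L₁ (fderiv ℝ (fderiv ℝ g₁) u.1 v.1 w.1) + L₂ (fderiv ℝ (fderiv ℝ g₂) u.2 v.2 w.2) := by
  have he : (fderiv ℝ fun z : E₁ × E₂ => L₁ (g₁ z.1) + L₂ (g₂ z.2)) =ᶠ[nhds u] fun z =>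
      L₁ ∘L fderiv ℝ g₁ z.1 ∘L .fst ℝ E₁ E₂ + L₂ ∘L fderiv ℝ g₂ z.2 ∘L .snd ℝ E₁ E₂ := by
    filter_upwards [continuousAt_fst.eventually h₁.eventually_differentiableAt,
      continuousAt_snd.eventually h₂.eventually_differentiableAt] with z hz₁ hz₂
    exact (hasFDerivAt_add_prod L₁ L₂ hz₁ hz₂).fderiv
  have hd₁ := h₁.differentiableAt_fderiv.hasFDerivAt.comp u hasFDerivAt_fst
  have hd₂ := h₂.differentiableAt_fderiv.hasFDerivAt.comp u hasFDerivAt_snd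
  have hd := ((hasFDerivAt_const L₁ u).clm_comp
    (hd₁.clm_comp (hasFDerivAt_const (ContinuousLinearMap.fst ℝ E₁ E₂) u))).add
    ((hasFDerivAt_const L₂ u).clm_comp
    (hd₂.clm_comp (hasFDerivAt_const (ContinuousLinearMap.snd ℝ E₁ E₂) u)))
  rw [(hd.congr_of_eventuallyEq he).fderiv]
  simp

end SumMaps

/-! ### Frames of products. -/

section ProductFrames

variable {ι κ E₁ E₂ V₁ V₂ V : Type*} [Fintype ι] [Fintype κ]
  [NormedAddCommGroup E₁] [NormedSpace ℝ E₁] [NormedAddCommGroup E₂] [NormedSpace ℝ E₂]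
  [NormedAddCommGroup V₁] [InnerProductSpace ℝ V₁] [NormedAddCommGroup V₂] [InnerProductSpace ℝ V₂]
  [NormedAddCommGroup V] [InnerProductSpace ℝ V]

theorem IsReproducingFrame.injective {D : E₁ →L[ℝ] V} {e : ι → E₁} (he : IsReproducingFrame D e) :
    Function.Injective D := by
  rw [injective_iff_map_eq_zero]
  intro v hv
  rw [← he v]
  simp [hv]

/-- A frame of a product, built from frames of the factors. -/
theorem IsReproducingFrame.prod {D₁ : E₁ →L[ℝ] V₁} {D₂ : E₂ →L[ℝ] V₂} {e₁ : ι → E₁} {e₂ : κ → E₂}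
    (h₁ : IsReproducingFrame D₁ e₁) (h₂ : IsReproducingFrame D₂ e₂)
    {A₁ : V₁ →L[ℝ] V} {A₂ : V₂ →L[ℝ] V} {r₁ r₂ s₁ s₂ : ℝ}
    (hA₁ : ∀ x y, inner ℝ (A₁ x) (A₁ y) = r₁ * inner ℝ x y)
    (hA₂ : ∀ x y, inner ℝ (A₂ x) (A₂ y) = r₂ * inner ℝ x y)
    (hA : ∀ x y, inner ℝ (A₁ x) (A₂ y) = 0) (hs₁ : s₁ ^ 2 * r₁ = 1) (hs₂ : s₂ ^ 2 * r₂ = 1) :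
    IsReproducingFrame (A₁ ∘L D₁ ∘L .fst ℝ E₁ E₂ + A₂ ∘L D₂ ∘L .snd ℝ E₁ E₂)
      (Sum.elim (fun i => (s₁ • e₁ i, 0)) fun j => (0, s₂ • e₂ j)) := by
  have hA' : ∀ x y, inner ℝ (A₂ y) (A₁ x) = 0 := fun x y => by rw [real_inner_comm, hA]
  rintro ⟨v, w⟩
  -- One `s₁` comes from the frame vector, the other from the inner product; together they cancel
  -- `r₁`.
  have e₁' : ∀ i, (s₁ * (r₁ * inner ℝ (D₁ (e₁ i)) (D₁ v))) • s₁ • e₁ i =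
      inner ℝ (D₁ (e₁ i)) (D₁ v) • e₁ i := fun i => by
    rw [smul_smul]; congr 1; linear_combination (inner ℝ (D₁ (e₁ i)) (D₁ v)) * hs₁
  have e₂' : ∀ j, (s₂ * (r₂ * inner ℝ (D₂ (e₂ j)) (D₂ w))) • s₂ • e₂ j =
      inner ℝ (D₂ (e₂ j)) (D₂ w) • e₂ j := fun j => by
    rw [smul_smul]; congr 1; linear_combination (inner ℝ (D₂ (e₂ j)) (D₂ w)) * hs₂
  ext
  · simp [inner_add_right, inner_smul_left, hA₁, hA, hA', Prod.fst_sum, e₁', h₁ v]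
  · simp [inner_add_right, inner_smul_left, hA₂, hA, hA', Prod.snd_sum, e₂', h₂ w]

end ProductFrames

/-! ### The trace equation of a minimal immersion. -/

section Minimality

variable {E : Type*} [NormedAddCommGroup E] [NormedSpace ℝ E]
  {H : Type*} [TopologicalSpace H] (I : ModelWithCorners ℝ E H) [I.Boundaryless]
  {M : Type*} [TopologicalSpace M] [ChartedSpace H M]
  {V : Type*} [NormedAddCommGroup V] [InnerProductSpace ℝ V] [FiniteDimensional ℝ V]

/-- For a minimal immersion into the unit sphere, the trace of the second derivative is the sum of a
tangent vector and of `-dim M` times the position vector. -/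
theorem exists_sum_fderiv_fderiv_orthonormalFrame_eq {f : M → V} (hf : ContMDiff I 𝓘(ℝ, V) ∞ f)
    (hr : ∀ y, ‖f y‖ = 1) {x : M} (hi : Function.Injective (ambientDifferential I f x))
    (hm : sphereMeanCurvature I f x = 0) :
    ∃ v : E, ∑ i, fderiv ℝ (fderiv ℝ (f ∘ (extChartAt I x).symm)) (extChartAt I x x)
        (orthonormalFrame I f x i) (orthonormalFrame I f x i) =
      ambientDifferential I f x v + (-(Module.finrank ℝ E : ℝ)) • f x := by
  rw [sphereMeanCurvature_eq I hi (isReproducingFrame_orthonormalFrame I hi),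
    starProjection_sphereNormalSubspace_eq_zero_iff] at hm
  obtain ⟨v, c, h⟩ := hm
  refine ⟨v, ?_⟩
  have hg : ContDiffAt ℝ 2 (f ∘ (extChartAt I x).symm) (extChartAt I x x) :=
    (hf.contDiffAt_comp_extChartAt_symm I x).of_le (WithTop.coe_le_coe.mpr le_top)
  have hD := ambientDifferential_eq_fderiv I (hf.mdifferentiableAt (x := x) (by simp))
  have hx : (f ∘ (extChartAt I x).symm) (extChartAt I x x) = f x := by simp
  have h2 := fun i => inner_fderiv_fderiv_eq hg (fun v => hr _)
    (orthonormalFrame I f x i) (orthonormalFrame I f x i)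
  have h1 := inner_fderiv_eq_zero (hg.differentiableAt (by norm_num)) (fun v => hr _) v
  rw [← hD, hx] at h1
  simp only [← hD, hx, real_inner_self_eq_norm_sq] at h2
  -- Pairing with the unit vector `f x` kills the tangent term and isolates `c`.
  have hc := congrArg (inner ℝ (f x)) h
  rw [inner_sum, Finset.sum_congr rfl fun i _ => h2 i, Finset.sum_neg_distrib,
    sum_norm_sq_orthonormalFrame I hi, inner_add_right, h1, inner_smul_right,
    real_inner_self_eq_norm_sq, hr] at hc
  rw [h, hc]
  simp

end Minimality

/-! ### Minimality of the scaled product. -/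

section Products

variable {E₁ : Type*} [NormedAddCommGroup E₁] [NormedSpace ℝ E₁]
  {H₁ : Type*} [TopologicalSpace H₁] (I₁ : ModelWithCorners ℝ E₁ H₁)
  {M₁ : Type*} [TopologicalSpace M₁] [ChartedSpace H₁ M₁]
  {V₁ : Type*} [NormedAddCommGroup V₁] [InnerProductSpace ℝ V₁]
  {E₂ : Type*} [NormedAddCommGroup E₂] [NormedSpace ℝ E₂]
  {H₂ : Type*} [TopologicalSpace H₂] (I₂ : ModelWithCorners ℝ E₂ H₂)
  {M₂ : Type*} [TopologicalSpace M₂] [ChartedSpace H₂ M₂]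
  {V₂ : Type*} [NormedAddCommGroup V₂] [InnerProductSpace ℝ V₂]
  {V : Type*} [NormedAddCommGroup V] [InnerProductSpace ℝ V]
  {A₁ : V₁ →L[ℝ] V} {A₂ : V₂ →L[ℝ] V} {r₁ r₂ : ℝ} {f₁ : M₁ → V₁} {f₂ : M₂ → V₂}

theorem contMDiff_add_prod (h₁ : ContMDiff I₁ 𝓘(ℝ, V₁) ∞ f₁) (h₂ : ContMDiff I₂ 𝓘(ℝ, V₂) ∞ f₂) :
    ContMDiff (I₁.prod I₂) 𝓘(ℝ, V) ∞ fun z : M₁ × M₂ => A₁ (f₁ z.1) + A₂ (f₂ z.2) :=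
  (A₁.contMDiff.comp (h₁.comp contMDiff_fst)).add (A₂.contMDiff.comp (h₂.comp contMDiff_snd))

theorem add_prod_comp_extChartAt_symm (x : M₁ × M₂) :
    (fun z : M₁ × M₂ => A₁ (f₁ z.1) + A₂ (f₂ z.2)) ∘ (extChartAt (I₁.prod I₂) x).symm =
      fun u : E₁ × E₂ => A₁ ((f₁ ∘ (extChartAt I₁ x.1).symm) u.1) +
        A₂ ((f₂ ∘ (extChartAt I₂ x.2).symm) u.2) := by
  rw [extChartAt_prod]
  rfl

variable [I₁.Boundaryless] [I₂.Boundaryless]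

theorem ambientDifferential_add_prod (h₁ : ContMDiff I₁ 𝓘(ℝ, V₁) ∞ f₁)
    (h₂ : ContMDiff I₂ 𝓘(ℝ, V₂) ∞ f₂) (x : M₁ × M₂) :
    ambientDifferential (I₁.prod I₂) (fun z : M₁ × M₂ => A₁ (f₁ z.1) + A₂ (f₂ z.2)) x =
      A₁ ∘L ambientDifferential I₁ f₁ x.1 ∘L .fst ℝ E₁ E₂ +
        A₂ ∘L ambientDifferential I₂ f₂ x.2 ∘L .snd ℝ E₁ E₂ := by
  rw [ambientDifferential_eq_fderiv _
      ((contMDiff_add_prod I₁ I₂ h₁ h₂).mdifferentiableAt (by simp)),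
    ambientDifferential_eq_fderiv _ (h₁.mdifferentiableAt (by simp)),
    ambientDifferential_eq_fderiv _ (h₂.mdifferentiableAt (by simp)),
    add_prod_comp_extChartAt_symm, extChartAt_prod]
  exact (hasFDerivAt_add_prod A₁ A₂
    ((h₁.contDiffAt_comp_extChartAt_symm I₁ x.1).differentiableAt (by simp))
    ((h₂.contDiffAt_comp_extChartAt_symm I₂ x.2).differentiableAt (by simp))).fderiv

variable [FiniteDimensional ℝ V₁] [FiniteDimensional ℝ V₂] [FiniteDimensional ℝ V]

/-- The combination of two minimal immersions into unit spheres through orthogonal conformal linear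
maps whose factors are proportional to the dimensions is an immersion with vanishing mean
curvature. -/
theorem injective_and_sphereMeanCurvature_add_prod
    (hA₁ : ∀ x y, inner ℝ (A₁ x) (A₁ y) = r₁ * inner ℝ x y)
    (hA₂ : ∀ x y, inner ℝ (A₂ x) (A₂ y) = r₂ * inner ℝ x y)
    (hA : ∀ x y, inner ℝ (A₁ x) (A₂ y) = 0) (hr₁ : 0 < r₁) (hr₂ : 0 < r₂)
    (hr : (Module.finrank ℝ E₁ : ℝ) / r₁ = Module.finrank ℝ E₂ / r₂)
    (h₁ : ContMDiff I₁ 𝓘(ℝ, V₁) ∞ f₁) (h₂ : ContMDiff I₂ 𝓘(ℝ, V₂) ∞ f₂)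
    (hn₁ : ∀ y, ‖f₁ y‖ = 1) (hn₂ : ∀ y, ‖f₂ y‖ = 1) (x : M₁ × M₂)
    (hi₁ : Function.Injective (ambientDifferential I₁ f₁ x.1))
    (hi₂ : Function.Injective (ambientDifferential I₂ f₂ x.2))
    (hm₁ : sphereMeanCurvature I₁ f₁ x.1 = 0) (hm₂ : sphereMeanCurvature I₂ f₂ x.2 = 0) :
    Function.Injective (ambientDifferential (I₁.prod I₂)
        (fun z : M₁ × M₂ => A₁ (f₁ z.1) + A₂ (f₂ z.2)) x) ∧
      sphereMeanCurvature (I₁.prod I₂) (fun z : M₁ × M₂ => A₁ (f₁ z.1) + A₂ (f₂ z.2)) x = 0 := by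
  have hs₁ : (√r₁)⁻¹ ^ 2 * r₁ = 1 := by
    rw [inv_pow, Real.sq_sqrt hr₁.le, inv_mul_cancel₀ hr₁.ne']
  have hs₂ : (√r₂)⁻¹ ^ 2 * r₂ = 1 := by
    rw [inv_pow, Real.sq_sqrt hr₂.le, inv_mul_cancel₀ hr₂.ne']
  generalize (√r₁)⁻¹ = s₁ at hs₁
  generalize (√r₂)⁻¹ = s₂ at hs₂
  have he := (isReproducingFrame_orthonormalFrame I₁ hi₁).prod
    (isReproducingFrame_orthonormalFrame I₂ hi₂) hA₁ hA₂ hA hs₁ hs₂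
  rw [← ambientDifferential_add_prod I₁ I₂ h₁ h₂ x] at he
  refine ⟨he.injective, ?_⟩
  rw [sphereMeanCurvature_eq (I₁.prod I₂) he.injective he,
    starProjection_sphereNormalSubspace_eq_zero_iff, ambientDifferential_add_prod I₁ I₂ h₁ h₂ x,
    add_prod_comp_extChartAt_symm, extChartAt_prod]
  have hg₁ : ContDiffAt ℝ 2 (f₁ ∘ (extChartAt I₁ x.1).symm) (extChartAt I₁ x.1 x.1) :=
    (h₁.contDiffAt_comp_extChartAt_symm I₁ x.1).of_le (WithTop.coe_le_coe.mpr le_top)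
  have hg₂ : ContDiffAt ℝ 2 (f₂ ∘ (extChartAt I₂ x.2).symm) (extChartAt I₂ x.2 x.2) :=
    (h₂.contDiffAt_comp_extChartAt_symm I₂ x.2).of_le (WithTop.coe_le_coe.mpr le_top)
  obtain ⟨v₁, hv₁⟩ := exists_sum_fderiv_fderiv_orthonormalFrame_eq I₁ h₁ hn₁ hi₁ hm₁
  obtain ⟨v₂, hv₂⟩ := exists_sum_fderiv_fderiv_orthonormalFrame_eq I₂ h₂ hn₂ hi₂ hm₂
  -- Since `s₁ ^ 2 = 1 / r₁` and `s₂ ^ 2 = 1 / r₂`, these are the rescaled tangent parts; by `hr`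
  -- one coefficient serves both position vectors.
  refine ⟨(s₁ ^ 2 • v₁, s₂ ^ 2 • v₂), -(Module.finrank ℝ E₁ / r₁), ?_⟩
  have hc₁ : s₁ ^ 2 * -(Module.finrank ℝ E₁ : ℝ) = -(Module.finrank ℝ E₁ / r₁) := by
    field_simp; linear_combination -(Module.finrank ℝ E₁ : ℝ) * hs₁
  have hc₂ : s₂ ^ 2 * -(Module.finrank ℝ E₂ : ℝ) = -(Module.finrank ℝ E₁ / r₁) := by
    rw [hr]; field_simp; linear_combination -(Module.finrank ℝ E₂ : ℝ) * hs₂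
  have key := fun v w => fderiv_fderiv_add_prod A₁ A₂
    (u := (extChartAt I₁ x.1 x.1, extChartAt I₂ x.2 x.2)) hg₁ hg₂ v w
  calc _ = A₁ (s₁ ^ 2 • ∑ i, fderiv ℝ (fderiv ℝ (f₁ ∘ (extChartAt I₁ x.1).symm))
          (extChartAt I₁ x.1 x.1) (orthonormalFrame I₁ f₁ x.1 i) (orthonormalFrame I₁ f₁ x.1 i)) +
        A₂ (s₂ ^ 2 • ∑ i, fderiv ℝ (fderiv ℝ (f₂ ∘ (extChartAt I₂ x.2).symm))
          (extChartAt I₂ x.2 x.2) (orthonormalFrame I₂ f₂ x.2 i)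
          (orthonormalFrame I₂ f₂ x.2 i)) := by
        rw [Fintype.sum_sum_type]
        simp only [PartialEquiv.prod_coe, key, Sum.elim_inl, Sum.elim_inr, map_zero, map_smul,
          add_zero, zero_add, map_sum, Finset.smul_sum,
          smul_apply, smul_smul, sq]
    _ = _ := by
        rw [hv₁, hv₂, smul_add, smul_add, smul_smul, smul_smul, hc₁, hc₂]
        simp only [map_add, map_smul, add_apply, ContinuousLinearMap.comp_apply,
          ContinuousLinearMap.coe_fst', ContinuousLinearMap.coe_snd', smul_add]
        abel

end Products

/-! ### Block vectors in Euclidean space. -/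

section BlockVectors

variable {p q : ℕ}

theorem inner_blockVector (x x' : EuclideanSpace ℝ (Fin (p + 1)))
    (y y' : EuclideanSpace ℝ (Fin (q + 1))) :
    inner ℝ (blockVector x y) (blockVector x' y') = inner ℝ x x' + inner ℝ y y' := by
  simp only [blockVector, PiLp.inner_apply]
  rw [← (finCongr (by omega : (p + 1) + (q + 1) = p + q + 1 + 1)).sum_comp, Fin.sum_univ_add]
  simp

theorem blockVector_add (x x' : EuclideanSpace ℝ (Fin (p + 1)))
    (y y' : EuclideanSpace ℝ (Fin (q + 1))) :
    blockVector (x + x') (y + y') = blockVector x y + blockVector x' y' := by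
  ext i
  obtain ⟨j, rfl⟩ := (finCongr (by omega : (p + 1) + (q + 1) = p + q + 1 + 1)).surjective i
  refine Fin.addCases (fun k => ?_) (fun k => ?_) j <;> simp [blockVector]

theorem blockVector_smul (c : ℝ) (x : EuclideanSpace ℝ (Fin (p + 1)))
    (y : EuclideanSpace ℝ (Fin (q + 1))) :
    blockVector (c • x) (c • y) = c • blockVector x y := by
  ext i
  obtain ⟨j, rfl⟩ := (finCongr (by omega : (p + 1) + (q + 1) = p + q + 1 + 1)).surjective i
  refine Fin.addCases (fun k => ?_) (fun k => ?_) j <;> simp [blockVector]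

/-- The map `(x, y) ↦ (a x, b y)` into the space of block vectors. -/
noncomputable def scaledBlock (p q : ℕ) (a b : ℝ) :
    EuclideanSpace ℝ (Fin (p + 1)) × EuclideanSpace ℝ (Fin (q + 1)) →ₗ[ℝ]
      EuclideanSpace ℝ (Fin (p + q + 1 + 1)) where
  toFun z := blockVector (a • z.1) (b • z.2)
  map_add' z w := by simp [smul_add, blockVector_add]
  map_smul' c z := by simp [smul_comm _ c, blockVector_smul]

theorem inner_scaledBlock (a b : ℝ)
    (z w : EuclideanSpace ℝ (Fin (p + 1)) × EuclideanSpace ℝ (Fin (q + 1))) :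
    inner ℝ (scaledBlock p q a b z) (scaledBlock p q a b w) =
      a ^ 2 * inner ℝ z.1 w.1 + b ^ 2 * inner ℝ z.2 w.2 := by
  simp only [scaledBlock, LinearMap.coe_mk, AddHom.coe_mk, inner_blockVector, inner_smul_left,
    inner_smul_right, conj_trivial]
  ring

theorem scaledBlock_injective {a b : ℝ} (ha : a ≠ 0) (hb : b ≠ 0) :
    Function.Injective (scaledBlock p q a b) := by
  rw [injective_iff_map_eq_zero]
  intro z hz
  have h := inner_scaledBlock a b z z
  rw [hz, inner_zero_left] at h
  have h₁ : 0 ≤ a ^ 2 * inner ℝ z.1 z.1 := mul_nonneg (sq_nonneg a) real_inner_self_nonneg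
  have h₂ : 0 ≤ b ^ 2 * inner ℝ z.2 z.2 := mul_nonneg (sq_nonneg b) real_inner_self_nonneg
  ext1
  · exact inner_self_eq_zero.mp ((mul_eq_zero.mp (by linarith)).resolve_left (pow_ne_zero 2 ha))
  · exact inner_self_eq_zero.mp ((mul_eq_zero.mp (by linarith)).resolve_left (pow_ne_zero 2 hb))

end BlockVectors

/-! ### Maps into the sphere versus maps into Euclidean space. -/

section SphereMaps

variable {E : Type*} [NormedAddCommGroup E] [NormedSpace ℝ E]
  {H : Type*} [TopologicalSpace H] {I : ModelWithCorners ℝ E H}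
  {M : Type*} [TopologicalSpace M] [ChartedSpace H M] {p : ℕ} {f : M → UnitSphere p}

theorem fact_finrank_euclideanSpace (p : ℕ) :
    Fact (Module.finrank ℝ (EuclideanSpace ℝ (Fin (p + 1))) = p + 1) :=
  ⟨finrank_euclideanSpace_fin⟩

theorem contMDiff_val_unitSphere (p : ℕ) :
    ContMDiff (𝓡 p) 𝓘(ℝ, EuclideanSpace ℝ (Fin (p + 1))) ∞
      (Subtype.val : UnitSphere p → EuclideanSpace ℝ (Fin (p + 1))) :=
  have := fact_finrank_euclideanSpace p
  contMDiff_coe_sphere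

theorem injective_mfderiv_val_unitSphere {p : ℕ} (x : UnitSphere p) :
    Function.Injective (mfderiv (𝓡 p) 𝓘(ℝ, EuclideanSpace ℝ (Fin (p + 1)))
      (Subtype.val : UnitSphere p → EuclideanSpace ℝ (Fin (p + 1))) x) := by
  have := fact_finrank_euclideanSpace p
  convert! injective_mvfderiv_subtypeVal_sphere x

theorem ambientDifferential_coe_sphere (hf : ContMDiff I (𝓡 p) ∞ f) (x : M) (v : E) :
    ambientDifferential I (fun y => (f y : EuclideanSpace ℝ (Fin (p + 1)))) x v =
      mfderiv (𝓡 p) 𝓘(ℝ, EuclideanSpace ℝ (Fin (p + 1)))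
        (Subtype.val : UnitSphere p → EuclideanSpace ℝ (Fin (p + 1))) (f x)
        (mfderiv I (𝓡 p) f x v) :=
  mfderiv_comp_apply x ((contMDiff_val_unitSphere p).mdifferentiableAt (by simp))
    (hf.mdifferentiableAt (by simp)) v

/-- The inclusion of the sphere is itself an immersion, so composing with it neither creates nor
destroys injectivity. -/
theorem injective_ambientDifferential_coe_sphere_iff (hf : ContMDiff I (𝓡 p) ∞ f) (x : M) :
    Function.Injective
        (ambientDifferential I (fun y => (f y : EuclideanSpace ℝ (Fin (p + 1)))) x) ↔
      Function.Injective (mfderiv I (𝓡 p) f x) := by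
  have h := (injective_mfderiv_val_unitSphere (f x)).of_comp_iff (mfderiv I (𝓡 p) f x)
  rw [← h]
  exact iff_of_eq (congrArg _ (funext fun v => ambientDifferential_coe_sphere hf x v))

end SphereMaps

/-! ### The main theorem. -/

theorem mainTheorem1 (n₁ n₂ p q : ℕ) (hn₁ : 0 < n₁) (hn₂ : 0 < n₂)
    {M₁ : Type*} [TopologicalSpace M₁] [ChartedSpace (EuclideanSpace ℝ (Fin n₁)) M₁]
    [IsManifold (𝓡 n₁) ∞ M₁]
    {M₂ : Type*} [TopologicalSpace M₂] [ChartedSpace (EuclideanSpace ℝ (Fin n₂)) M₂]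
    [IsManifold (𝓡 n₂) ∞ M₂]
    (f₁ : M₁ → UnitSphere p) (f₂ : M₂ → UnitSphere q)
    (h₁ : IsMinimalInSphere (𝓡 n₁) f₁) (h₂ : IsMinimalInSphere (𝓡 n₂) f₂) :
    ∃ F : M₁ × M₂ → UnitSphere (p + q + 1),
      (∀ x y, (F (x, y) : EuclideanSpace ℝ (Fin (p + q + 1 + 1))) =
        blockVector (√((n₁ : ℝ) / (n₁ + n₂)) • (f₁ x : EuclideanSpace ℝ (Fin (p + 1))))
          (√((n₂ : ℝ) / (n₁ + n₂)) • (f₂ y : EuclideanSpace ℝ (Fin (q + 1))))) ∧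
      IsMinimalInSphere ((𝓡 n₁).prod (𝓡 n₂)) F ∧
      (Topology.IsEmbedding f₁ → Topology.IsEmbedding f₂ → Topology.IsEmbedding F) := by
  have hn₁' : (0 : ℝ) < n₁ := Nat.cast_pos.mpr hn₁
  have hn₂' : (0 : ℝ) < n₂ := Nat.cast_pos.mpr hn₂
  set r₁ : ℝ := (n₁ : ℝ) / (n₁ + n₂) with hr₁
  set r₂ : ℝ := (n₂ : ℝ) / (n₁ + n₂) with hr₂
  have hr₁0 : 0 < r₁ := by positivity
  have hr₂0 : 0 < r₂ := by positivity
  have hsum : r₁ + r₂ = 1 := by rw [hr₁, hr₂]; field_simp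
  set L := scaledBlock p q √r₁ √r₂ with hL
  have hLi : ∀ z w, inner ℝ (L z) (L w) = r₁ * inner ℝ z.1 w.1 + r₂ * inner ℝ z.2 w.2 := by
    intro z w
    rw [hL, inner_scaledBlock, Real.sq_sqrt hr₁0.le, Real.sq_sqrt hr₂0.le]
  have hf₁ : ∀ x, ‖(f₁ x : EuclideanSpace ℝ (Fin (p + 1)))‖ = 1 := fun x =>
    mem_sphere_zero_iff_norm.mp (f₁ x).2
  have hf₂ : ∀ y, ‖(f₂ y : EuclideanSpace ℝ (Fin (q + 1)))‖ = 1 := fun y =>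
    mem_sphere_zero_iff_norm.mp (f₂ y).2
  let G : M₁ × M₂ → EuclideanSpace ℝ (Fin (p + q + 1 + 1)) := fun z => L (f₁ z.1, f₂ z.2)
  have hG : ∀ z, G z ∈ Metric.sphere (0 : EuclideanSpace ℝ (Fin (p + q + 1 + 1))) 1 := by
    intro z
    have h : ‖G z‖ ^ 2 = 1 := by
      rw [← real_inner_self_eq_norm_sq, hLi, real_inner_self_eq_norm_sq,
        real_inner_self_eq_norm_sq, hf₁, hf₂, one_pow, mul_one, mul_one, hsum]
    rw [mem_sphere_zero_iff_norm]
    exact (pow_eq_one_iff_of_nonneg (norm_nonneg _) two_ne_zero).mp h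
  let A₁ := L.toContinuousLinearMap ∘L .inl ℝ _ _
  let A₂ := L.toContinuousLinearMap ∘L .inr ℝ _ _
  have hGA : G = fun z => A₁ (f₁ z.1) + A₂ (f₂ z.2) := by
    funext z
    simp [A₁, A₂, G, ← map_add]
  have hc₁ := (contMDiff_val_unitSphere p).comp h₁.contMDiff
  have hc₂ := (contMDiff_val_unitSphere q).comp h₂.contMDiff
  have hGc : ContMDiff ((𝓡 n₁).prod (𝓡 n₂)) 𝓘(ℝ, EuclideanSpace ℝ (Fin (p + q + 1 + 1))) ∞ G := by
    rw [hGA]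
    exact contMDiff_add_prod _ _ hc₁ hc₂
  have hFc : ContMDiff ((𝓡 n₁).prod (𝓡 n₂)) (𝓡 (p + q + 1)) ∞
      fun z => (⟨G z, hG z⟩ : UnitSphere (p + q + 1)) :=
    have := fact_finrank_euclideanSpace (p + q + 1)
    hGc.codRestrict_sphere hG
  have key := fun z => injective_and_sphereMeanCurvature_add_prod (𝓡 n₁) (𝓡 n₂)
    (A₁ := A₁) (A₂ := A₂) (r₁ := r₁) (r₂ := r₂)
    (fun x y => by simp [A₁, hLi]) (fun x y => by simp [A₂, hLi]) (fun x y => by simp [A₁, A₂, hLi])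
    hr₁0 hr₂0
    -- Both quotients equal `n₁ + n₂`.
    (by rw [finrank_euclideanSpace_fin, finrank_euclideanSpace_fin, hr₁, hr₂]; field_simp)
    hc₁ hc₂ hf₁ hf₂ z
    ((injective_ambientDifferential_coe_sphere_iff h₁.contMDiff z.1).mpr (h₁.immersion z.1))
    ((injective_ambientDifferential_coe_sphere_iff h₂.contMDiff z.2).mpr (h₂.immersion z.2))
    (h₁.meanCurvature_eq_zero z.1) (h₂.meanCurvature_eq_zero z.2)
  refine ⟨fun z => ⟨G z, hG z⟩, fun x y => rfl, ⟨hFc, fun z => ?_, fun z => ?_⟩, fun e₁ e₂ => ?_⟩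
  · rw [← injective_ambientDifferential_coe_sphere_iff hFc z]
    change Function.Injective (ambientDifferential _ G z)
    rw [hGA]
    exact (key z).1
  · change sphereMeanCurvature _ G z = 0
    rw [hGA]
    exact (key z).2
  -- It suffices that `G` is an embedding: it is `f₁ × f₂` followed by an injective linear map
  -- between finite-dimensional spaces.
  · refine .of_comp hFc.continuous continuous_subtype_val ?_
    exact (L.isClosedEmbedding_of_injective (LinearMap.ker_eq_bot.mpr (scaledBlock_injective
      (Real.sqrt_pos.mpr hr₁0).ne' (Real.sqrt_pos.mpr hr₂0).ne'))).isEmbedding.comp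
      ((Topology.IsEmbedding.subtypeVal.comp e₁).prodMap (Topology.IsEmbedding.subtypeVal.comp e₂))
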